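/- A nonstandard extension of a pair of nonempty sets $(M,N)$ (a two-sorted structure) consists of nonempty sets ${}^*M,{}^*N$ and a mapping assigning to every $A\subseteq M^m\times N^n$ ($m,n\ge 0$) a set ${}^*A\subseteq({}^*M)^m\times({}^*N)^n$, with ${}^*(M^m\times N^n)=({}^*M)^m\times({}^*N)^n$, that preserves unions, intersections and set differences, the diagonals $\{x_i=x_j\}$ (for two coordinates of the same sort), Cartesian products, and projections omitting the last coordinate of either sort. Each function $f$ and each relation on $M,N$ then extends to ${}^*M,{}^*N$: the extension of $f$ is the function whose graph is the set assigned to the graph of $f$. The extension of $f$ is again denoted $f$. Let $K=\overline{\mathbb Q}$, and let $h:K\to\mathbb R$ be the absolute logarithmic height, $h(\alpha)=\frac1{[F:\mathbb Q]}\log\prod_{v\in M_F}\max\{1,\|\alpha\|_v\}$, where $F=\mathbb Q(\alpha)$, $M_F$ is the set of places of $F$ and $\|\cdot\|_v=|\cdot|_v^{[F_v:\mathbb Q_v]}$ are the usual normalized absolute values satisfying the product formula. Let $({}^*K,{}^*\mathbb R)$ be any nonstandard extension of $(K,\mathbb R)$, so that ${}^*K$ is a field under the extended operations and $h$ extends to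 $h:{}^*K\to{}^*\mathbb R$. Put ${\mathbb R}_{fin}=\{y\in{}^*\mathbb R : |y|<n \text{ for some } n\in\mathbb N\}$ and $$L=\{x\in{}^*K : h(x)\in{\mathbb R}_{fin}\}.$$ **Lemma 3.4.** $L$ is a subfield of ${}^*K$, and $L$ is an algebraically closed field. -/

import Mathlib

/-!
# Nonstandard extensions of two-sorted structures and elements of finite height
-/

universe u v w

/-- A nonstandard extension of a pair of base sets `(M, N)` (a two-sorted structure): nonempty sets
`*M = Fst` and `*N = Snd` and a mapping that assigns to every subset `A` of `M ^ m × N ^ n`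
(for all `m, n ≥ 0`) a subset `*A` of `(*M) ^ m × (*N) ^ n`, such that Boolean operations, basic
diagonals, Cartesian products and projections omitting the final coordinate (of either sort) are
preserved. Every function and relation on `M, N` thereby extends to `*M, *N`. -/
structure NonstandardExtension (M : Type u) (N : Type v) where
  /-- the set `*M` -/
  Fst : Type w
  /-- the set `*N` -/
  Snd : Type w
  nonempty_fst : Nonempty Fst
  nonempty_snd : Nonempty Snd
  /-- the mapping `A ↦ *A` -/
  star : ∀ {m n : ℕ}, Set ((Fin m → M) × (Fin n → N)) → Set ((Fin m → Fst) × (Fin n → Snd))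
  /-- `*M` and `*N` are the sets assigned to `M` and `N` -/
  star_univ : ∀ m n : ℕ,
    star (Set.univ : Set ((Fin m → M) × (Fin n → N))) = Set.univ
  star_union : ∀ {m n : ℕ} (A B : Set ((Fin m → M) × (Fin n → N))),
    star (A ∪ B) = star A ∪ star B
  star_inter : ∀ {m n : ℕ} (A B : Set ((Fin m → M) × (Fin n → N))),
    star (A ∩ B) = star A ∩ star B
  star_diff : ∀ {m n : ℕ} (A B : Set ((Fin m → M) × (Fin n → N))),
    star (A \ B) = star A \ star B
  star_diag_fst : ∀ {m n : ℕ} (i j : Fin m), i < j →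
    star {p : (Fin m → M) × (Fin n → N) | p.1 i = p.1 j} = {p | p.1 i = p.1 j}
  star_diag_snd : ∀ {m n : ℕ} (i j : Fin n), i < j →
    star {p : (Fin m → M) × (Fin n → N) | p.2 i = p.2 j} = {p | p.2 i = p.2 j}
  star_prod : ∀ {m n m' n' : ℕ} (A : Set ((Fin m → M) × (Fin n → N)))
    (B : Set ((Fin m' → M) × (Fin n' → N))),
    star {p : (Fin (m + m') → M) × (Fin (n + n') → N) |
        (p.1 ∘ Fin.castAdd m', p.2 ∘ Fin.castAdd n') ∈ A ∧
        (p.1 ∘ Fin.natAdd m, p.2 ∘ Fin.natAdd n) ∈ B} =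
      {p | (p.1 ∘ Fin.castAdd m', p.2 ∘ Fin.castAdd n') ∈ star A ∧
        (p.1 ∘ Fin.natAdd m, p.2 ∘ Fin.natAdd n) ∈ star B}
  star_proj_fst : ∀ {m n : ℕ} (A : Set ((Fin (m + 1) → M) × (Fin n → N))),
    star ((fun p => (p.1 ∘ Fin.castSucc, p.2)) '' A) =
      (fun p => (p.1 ∘ Fin.castSucc, p.2)) '' star A
  star_proj_snd : ∀ {m n : ℕ} (A : Set ((Fin m → M) × (Fin (n + 1) → N))),
    star ((fun p => (p.1, p.2 ∘ Fin.castSucc)) '' A) =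
      (fun p => (p.1, p.2 ∘ Fin.castSucc)) '' star A

namespace NonstandardExtension

variable {M : Type u} {N : Type v} (E : NonstandardExtension.{u, v, w} M N)

/-- The same extension with the two sorts exchanged. -/
def swap : NonstandardExtension.{v, u, w} N M where
  Fst := E.Snd
  Snd := E.Fst
  nonempty_fst := E.nonempty_snd
  nonempty_snd := E.nonempty_fst
  star A := Prod.swap ⁻¹' E.star (Prod.swap ⁻¹' A)
  star_univ m n := by rw [Set.preimage_univ, E.star_univ, Set.preimage_univ]
  star_union A B := by rw [Set.preimage_union, E.star_union, Set.preimage_union]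
  star_inter A B := by rw [Set.preimage_inter, E.star_inter, Set.preimage_inter]
  star_diff A B := by rw [Set.preimage_sdiff, E.star_diff, Set.preimage_sdiff]
  star_diag_fst i j h := by
    exact congrArg (Prod.swap ⁻¹' ·) (E.star_diag_snd i j h)
  star_diag_snd i j h := by
    exact congrArg (Prod.swap ⁻¹' ·) (E.star_diag_fst i j h)
  star_prod A B := congrArg (Prod.swap ⁻¹' ·)
    (E.star_prod (Prod.swap ⁻¹' A) (Prod.swap ⁻¹' B))
  star_proj_fst A := by
    have := congrArg (Prod.swap ⁻¹' ·) (E.star_proj_snd (Prod.swap ⁻¹' A))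
    simp only [← Set.image_swap_eq_preimage_swap, Set.image_image] at this ⊢
    exact this
  star_proj_snd A := by
    have := congrArg (Prod.swap ⁻¹' ·) (E.star_proj_fst (Prod.swap ⁻¹' A))
    simp only [← Set.image_swap_eq_preimage_swap, Set.image_image] at this ⊢
    exact this

theorem star_mono {m n : ℕ} {A B : Set ((Fin m → M) × (Fin n → N))} (h : A ⊆ B) :
    E.star A ⊆ E.star B := by
  rw [← Set.union_eq_self_of_subset_left h, E.star_union]
  exact Set.subset_union_left

theorem star_iInter {m n k : ℕ} (A : Fin k → Set ((Fin m → M) × (Fin n → N))) :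
    E.star (⋂ i, A i) = ⋂ i, E.star (A i) := by
  induction k with
  | zero => simp [E.star_univ]
  | succ k ih =>
    have h1 : (⋂ i, A i) = A 0 ∩ ⋂ i : Fin k, A i.succ := by
      ext x; simp [Fin.forall_fin_succ]
    have h2 : (⋂ i, E.star (A i)) = E.star (A 0) ∩ ⋂ i : Fin k, E.star (A i.succ) := by
      ext x; simp [Fin.forall_fin_succ]
    rw [h1, h2, E.star_inter, ih]

theorem exists_append_zero {α β : Type*} {m n : ℕ} (A : Set ((Fin (m + 0) → α) × (Fin n → β))) :
    {p : (Fin m → α) × (Fin n → β) | ∃ y : Fin 0 → α, (Fin.append p.1 y, p.2) ∈ A} = A := by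
  have h : ∀ (x : Fin m → α) (y : Fin 0 → α), Fin.append x y = x := by
    intro x y
    rw [Subsingleton.elim y Fin.elim0, Fin.append_elim0]
    rfl
  ext p
  exact ⟨fun ⟨y, hy⟩ => by rwa [h] at hy, fun hp => ⟨Fin.elim0, by rwa [h]⟩⟩

theorem exists_append_succ {α β : Type*} {m n k : ℕ}
    (A : Set ((Fin (m + k + 1) → α) × (Fin n → β))) :
    {p : (Fin m → α) × (Fin n → β) | ∃ y : Fin (k + 1) → α,
        ((Fin.append p.1 y : Fin (m + (k + 1)) → α), p.2) ∈ A} =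
      {p | ∃ y : Fin k → α, (Fin.append p.1 y, p.2) ∈
        (fun q : (Fin (m + k + 1) → α) × (Fin n → β) => (q.1 ∘ Fin.castSucc, q.2)) '' A} := by
  have key : ∀ (x : Fin m → α) (y : Fin (k + 1) → α),
      (Fin.append x y : Fin (m + (k + 1)) → α) ∘ (Fin.castSucc : Fin (m + k) → Fin (m + k + 1)) =
        Fin.append x (y ∘ Fin.castSucc) := by
    intro x y
    funext i
    induction i using Fin.addCases with
    | left i => exact (Fin.append_left x y i).trans (Fin.append_left x _ i).symm
    | right i => exact (Fin.append_right x y i.castSucc).trans (Fin.append_right x (y ∘ Fin.castSucc) i).symm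
  ext p
  constructor
  · rintro ⟨y, hy⟩
    exact ⟨y ∘ Fin.castSucc, _, hy, Prod.ext (key p.1 y) rfl⟩
  · rintro ⟨y, q, hq, h⟩
    refine ⟨Fin.snoc (α := fun _ => α) y (q.1 (Fin.last _)), ?_⟩
    have h1 : q.1 ∘ Fin.castSucc = Fin.append p.1 y := congrArg Prod.fst h
    have h2 : q.2 = p.2 := congrArg Prod.snd h
    have : ((Fin.append p.1 (Fin.snoc (α := fun _ => α) y (q.1 (Fin.last _))) :
        Fin (m + (k + 1)) → α), p.2) = q := by
      refine Prod.ext ?_ h2.symm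
      rw [Fin.append_snoc, ← h1]
      exact Fin.snoc_init_self (α := fun _ => α) q.1
    rwa [this]

theorem star_exists_fst {m n : ℕ} (k : ℕ) (A : Set ((Fin (m + k) → M) × (Fin n → N))) :
    E.star {p : (Fin m → M) × (Fin n → N) | ∃ y : Fin k → M, (Fin.append p.1 y, p.2) ∈ A} =
      {p | ∃ y : Fin k → E.Fst, (Fin.append p.1 y, p.2) ∈ E.star A} := by
  induction k with
  | zero => rw [exists_append_zero, exists_append_zero]
  | succ k ih =>
    have h := ih ((fun q : (Fin (m + k + 1) → M) × (Fin n → N) => (q.1 ∘ Fin.castSucc, q.2)) '' A)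
    have h2 := E.star_proj_fst (m := m + k) A
    rw [h2] at h
    exact (congrArg E.star (exists_append_succ A)).trans
      (h.trans (exists_append_succ (E.star A)).symm)

theorem star_exists_snd {m n : ℕ} (k : ℕ) (A : Set ((Fin m → M) × (Fin (n + k) → N))) :
    E.star {p : (Fin m → M) × (Fin n → N) | ∃ y : Fin k → N, (p.1, Fin.append p.2 y) ∈ A} =
      {p | ∃ y : Fin k → E.Snd, (p.1, Fin.append p.2 y) ∈ E.star A} :=
  congrArg (Prod.swap ⁻¹' ·) (E.swap.star_exists_fst k (Prod.swap ⁻¹' A))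

theorem star_exists {m n : ℕ} (k l : ℕ) (A : Set ((Fin (m + k) → M) × (Fin (n + l) → N))) :
    E.star {p : (Fin m → M) × (Fin n → N) | ∃ (y : Fin k → M) (z : Fin l → N),
        (Fin.append p.1 y, Fin.append p.2 z) ∈ A} =
      {p | ∃ (y : Fin k → E.Fst) (z : Fin l → E.Snd),
        (Fin.append p.1 y, Fin.append p.2 z) ∈ E.star A} := by
  have h := E.star_exists_fst (m := m) k
    {p : (Fin (m + k) → M) × (Fin n → N) | ∃ z : Fin l → N, (p.1, Fin.append p.2 z) ∈ A}
  rw [E.star_exists_snd l A] at h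
  exact h

theorem star_eq_fst {m n : ℕ} (i j : Fin m) :
    E.star {p : (Fin m → M) × (Fin n → N) | p.1 i = p.1 j} = {p | p.1 i = p.1 j} := by
  rcases lt_trichotomy i j with h | rfl | h
  · exact E.star_diag_fst i j h
  · simpa using! E.star_univ m n
  · simpa only [eq_comm] using E.star_diag_fst (n := n) j i h

theorem star_eq_snd {m n : ℕ} (i j : Fin n) :
    E.star {p : (Fin m → M) × (Fin n → N) | p.2 i = p.2 j} = {p | p.2 i = p.2 j} :=
  congrArg (Prod.swap ⁻¹' ·) (E.swap.star_eq_fst (n := m) i j)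

theorem star_forall {m n k : ℕ} (p : Fin k → (Fin m → M) × (Fin n → N) → Prop) :
    E.star {x | ∀ i, p i x} = {x | ∀ i, x ∈ E.star {x | p i x}} := by
  have := E.star_iInter (fun i => {x | p i x})
  ext x
  have h := congrArg (x ∈ ·) this
  simpa [Set.mem_iInter, Set.ofPred_forall] using h

theorem star_and {m n : ℕ} (p q : (Fin m → M) × (Fin n → N) → Prop) :
    E.star {x | p x ∧ q x} = {x | x ∈ E.star {x | p x} ∧ x ∈ E.star {x | q x}} :=
  E.star_inter {x | p x} {x | q x}

theorem star_right {m n k l : ℕ} (A : Set ((Fin k → M) × (Fin l → N))) :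
    E.star {p : (Fin (m + k) → M) × (Fin (n + l) → N) |
        (p.1 ∘ Fin.natAdd m, p.2 ∘ Fin.natAdd n) ∈ A} =
      {p | (p.1 ∘ Fin.natAdd m, p.2 ∘ Fin.natAdd n) ∈ E.star A} := by
  simpa [E.star_univ] using E.star_prod (m := m) (n := n) Set.univ A

theorem star_left {m n k l : ℕ} (A : Set ((Fin m → M) × (Fin n → N))) :
    E.star {p : (Fin (m + k) → M) × (Fin (n + l) → N) |
        (p.1 ∘ Fin.castAdd k, p.2 ∘ Fin.castAdd l) ∈ A} =
      {p | (p.1 ∘ Fin.castAdd k, p.2 ∘ Fin.castAdd l) ∈ E.star A} := by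
  simpa [E.star_univ] using E.star_prod (m' := k) (n' := l) A Set.univ

theorem append_comp_castAdd {α : Type*} {m k : ℕ} (x : Fin m → α) (y : Fin k → α) :
    Fin.append x y ∘ Fin.castAdd k = x := funext fun i => Fin.append_left x y i

theorem append_comp_natAdd {α : Type*} {m k : ℕ} (x : Fin m → α) (y : Fin k → α) :
    Fin.append x y ∘ Fin.natAdd m = y := funext fun i => Fin.append_right x y i

theorem reindex_eq {α β : Type*} {m n k l : ℕ} (s : Fin k → Fin m) (t : Fin l → Fin n)
    (A : Set ((Fin k → α) × (Fin l → β))) :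
    {p : (Fin m → α) × (Fin n → β) | (p.1 ∘ s, p.2 ∘ t) ∈ A} =
      {p | ∃ (y : Fin k → α) (z : Fin l → β), (Fin.append p.1 y, Fin.append p.2 z) ∈
        {q : (Fin (m + k) → α) × (Fin (n + l) → β) |
          (q.1 ∘ Fin.natAdd m, q.2 ∘ Fin.natAdd n) ∈ A ∧
          (∀ i, q.1 (Fin.natAdd m i) = q.1 (Fin.castAdd k (s i))) ∧
          ∀ j, q.2 (Fin.natAdd n j) = q.2 (Fin.castAdd l (t j))}} := by
  ext p
  simp only [Set.mem_ofPred_eq, append_comp_natAdd, Fin.append_right, Fin.append_left]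
  constructor
  · exact fun h => ⟨_, _, h, fun _ => rfl, fun _ => rfl⟩
  · rintro ⟨y, z, h, hy, hz⟩
    obtain rfl : y = p.1 ∘ s := funext hy
    obtain rfl : z = p.2 ∘ t := funext hz
    exact h

/-- The mapping `A ↦ *A` commutes with permuting, repeating and omitting coordinates. -/
theorem star_reindex {m n k l : ℕ} (s : Fin k → Fin m) (t : Fin l → Fin n)
    (A : Set ((Fin k → M) × (Fin l → N))) :
    E.star {p : (Fin m → M) × (Fin n → N) | (p.1 ∘ s, p.2 ∘ t) ∈ A} =
      {p | (p.1 ∘ s, p.2 ∘ t) ∈ E.star A} := by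
  rw [reindex_eq, E.star_exists, reindex_eq, E.star_and, E.star_and, E.star_forall, E.star_forall,
    E.star_right]
  simp only [E.star_eq_fst, E.star_eq_snd]
  rfl

/-- The graph of a function `M ^ m × N ^ n → M`. -/
def graphFst {m n : ℕ} (f : (Fin m → M) × (Fin n → N) → M) :
    Set ((Fin (m + 1) → M) × (Fin n → N)) :=
  {q | q.1 (Fin.last m) = f (q.1 ∘ Fin.castSucc, q.2)}

/-- The graph of a function `M ^ m × N ^ n → N`. -/
def graphSnd {m n : ℕ} (f : (Fin m → M) × (Fin n → N) → N) :
    Set ((Fin m → M) × (Fin (n + 1) → N)) :=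
  {q | q.2 (Fin.last n) = f (q.1, q.2 ∘ Fin.castSucc)}

theorem snoc_comp {α : Type*} {m : ℕ} (x : Fin m → α) (y : α) :
    (Fin.snoc x y : Fin (m + 1) → α) ∘ Fin.castSucc = x :=
  funext fun i => Fin.snoc_castSucc (α := fun _ => α) y x i

theorem existsUnique_starFst {m n : ℕ} (f : (Fin m → M) × (Fin n → N) → M)
    (a : (Fin m → E.Fst) × (Fin n → E.Snd)) :
    ∃! y : E.Fst, ((Fin.snoc a.1 y : Fin (m + 1) → E.Fst), a.2) ∈ E.star (graphFst f) := by
  apply existsUnique_of_exists_of_unique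
  · have h : (fun p : (Fin (m + 1) → M) × (Fin n → N) => (p.1 ∘ Fin.castSucc, p.2)) ''
        graphFst f = Set.univ := by
      refine Set.eq_univ_of_forall fun p => ⟨(Fin.snoc p.1 (f p), p.2), ?_, ?_⟩
      · simp [graphFst]
      · simp
    have h2 := E.star_proj_fst (graphFst f)
    rw [h, E.star_univ] at h2
    obtain ⟨q, hq, hqa⟩ : a ∈ (fun p : (Fin (m + 1) → E.Fst) × (Fin n → E.Snd) =>
      (p.1 ∘ Fin.castSucc, p.2)) '' E.star (graphFst f) := h2 ▸ Set.mem_univ a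
    refine ⟨q.1 (Fin.last m), ?_⟩
    subst hqa
    have : (Fin.snoc (q.1 ∘ Fin.castSucc) (q.1 (Fin.last m)) : Fin (m + 1) → E.Fst) = q.1 :=
      Fin.snoc_init_self (α := fun _ => E.Fst) q.1
    rw [this]
    exact hq
  · intro y z hy hz
    have h : {p : (Fin (m + 2) → M) × (Fin n → N) |
          (p.1 ∘ Fin.castSucc, p.2 ∘ id) ∈ graphFst f ∧
          (p.1 ∘ (Fin.snoc (Fin.castSucc ∘ Fin.castSucc) (Fin.last (m + 1)) :
            Fin (m + 1) → Fin (m + 2)), p.2 ∘ id) ∈ graphFst f} ⊆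
        {p | p.1 (Fin.last m).castSucc = p.1 (Fin.last (m + 1))} := by
      rintro p ⟨h1, h2⟩
      simp only [graphFst, Set.mem_ofPred_eq, Function.comp_apply, Fin.snoc_last,
        Function.comp_assoc, snoc_comp] at h1 h2
      exact h1.trans h2.symm
    have h' := E.star_mono h
    rw [E.star_and, E.star_eq_fst, E.star_reindex, E.star_reindex] at h'
    have h3 := @h' ((Fin.snoc (Fin.snoc a.1 y : Fin (m + 1) → E.Fst) z : Fin (m + 2) → E.Fst), a.2)
    simp only [Set.mem_ofPred_eq, snoc_comp, Function.comp_id, Fin.snoc_castSucc,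
      Fin.snoc_last] at h3
    refine h3 ⟨hy, ?_⟩
    convert hz using 2
    funext i
    induction i using Fin.lastCases with
    | last => simp
    | cast i => simp

/-- The extension `*f : (*M) ^ m × (*N) ^ n → *M` of a function `f : M ^ m × N ^ n → M`: the
function whose graph is `*(graph f)`. -/
noncomputable def starFst {m n : ℕ} (f : (Fin m → M) × (Fin n → N) → M)
    (a : (Fin m → E.Fst) × (Fin n → E.Snd)) : E.Fst :=
  (E.existsUnique_starFst f a).choose

theorem starFst_eq_iff {m n : ℕ} (f : (Fin m → M) × (Fin n → N) → M)
    (a : (Fin m → E.Fst) × (Fin n → E.Snd)) (y : E.Fst) :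
    E.starFst f a = y ↔ ((Fin.snoc a.1 y : Fin (m + 1) → E.Fst), a.2) ∈ E.star (graphFst f) := by
  have h := (E.existsUnique_starFst f a).choose_spec
  exact ⟨fun hy => hy ▸ h.1, fun hy => (h.2 y hy).symm⟩

theorem existsUnique_starSnd {m n : ℕ} (f : (Fin m → M) × (Fin n → N) → N)
    (a : (Fin m → E.Fst) × (Fin n → E.Snd)) :
    ∃! y : E.Snd, (a.1, (Fin.snoc a.2 y : Fin (n + 1) → E.Snd)) ∈ E.star (graphSnd f) :=
  E.swap.existsUnique_starFst (fun p => f p.swap) a.swap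

/-- The extension `*f : (*M) ^ m × (*N) ^ n → *N` of a function `f : M ^ m × N ^ n → N`: the
function whose graph is `*(graph f)`. -/
noncomputable def starSnd {m n : ℕ} (f : (Fin m → M) × (Fin n → N) → N)
    (a : (Fin m → E.Fst) × (Fin n → E.Snd)) : E.Snd :=
  (E.existsUnique_starSnd f a).choose

theorem starSnd_eq_iff {m n : ℕ} (f : (Fin m → M) × (Fin n → N) → N)
    (a : (Fin m → E.Fst) × (Fin n → E.Snd)) (y : E.Snd) :
    E.starSnd f a = y ↔ (a.1, (Fin.snoc a.2 y : Fin (n + 1) → E.Snd)) ∈ E.star (graphSnd f) := by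
  have h := (E.existsUnique_starSnd f a).choose_spec
  exact ⟨fun hy => hy ▸ h.1, fun hy => (h.2 y hy).symm⟩

theorem comp_eq {α β : Type*} {m n k l : ℕ} (f : Fin k → (Fin m → α) × (Fin n → β) → α)
    (g : Fin l → (Fin m → α) × (Fin n → β) → β) (A : Set ((Fin k → α) × (Fin l → β))) :
    {p : (Fin m → α) × (Fin n → β) | (fun i => f i p, fun j => g j p) ∈ A} =
      {p | ∃ (y : Fin k → α) (z : Fin l → β), (Fin.append p.1 y, Fin.append p.2 z) ∈
        {q : (Fin (m + k) → α) × (Fin (n + l) → β) |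
          (q.1 ∘ Fin.natAdd m, q.2 ∘ Fin.natAdd n) ∈ A ∧
          (∀ i, f i (q.1 ∘ Fin.castAdd k, q.2 ∘ Fin.castAdd l) = q.1 (Fin.natAdd m i)) ∧
          ∀ j, g j (q.1 ∘ Fin.castAdd k, q.2 ∘ Fin.castAdd l) = q.2 (Fin.natAdd n j)}} := by
  ext p
  simp only [Set.mem_ofPred_eq, append_comp_natAdd, append_comp_castAdd, Fin.append_right]
  constructor
  · exact fun h => ⟨_, _, h, fun _ => rfl, fun _ => rfl⟩
  · rintro ⟨y, z, h, hy, hz⟩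
    obtain rfl : (fun i => f i p) = y := funext hy
    obtain rfl : (fun j => g j p) = z := funext hz
    exact h

theorem comp_snoc {α γ : Type*} {k : ℕ} (x : γ → α) (s : Fin k → γ) (c : γ) :
    x ∘ (Fin.snoc s c : Fin (k + 1) → γ) = Fin.snoc (x ∘ s) (x c) :=
  Fin.comp_snoc x s c

theorem star_graph_fst {m n k l : ℕ} (f : (Fin m → M) × (Fin n → N) → M) (i : Fin k) :
    E.star {q : (Fin (m + k) → M) × (Fin (n + l) → N) |
        f (q.1 ∘ Fin.castAdd k, q.2 ∘ Fin.castAdd l) = q.1 (Fin.natAdd m i)} =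
      {q | E.starFst f (q.1 ∘ Fin.castAdd k, q.2 ∘ Fin.castAdd l) = q.1 (Fin.natAdd m i)} := by
  have h := E.star_reindex (Fin.snoc (Fin.castAdd k) (Fin.natAdd m i) : Fin (m + 1) → Fin (m + k))
    (Fin.castAdd l : Fin n → Fin (n + l)) (graphFst f)
  simp only [comp_snoc] at h
  simp only [starFst_eq_iff, ← h]
  simp [graphFst, eq_comm]

theorem star_graph_snd {m n k l : ℕ} (g : (Fin m → M) × (Fin n → N) → N) (j : Fin l) :
    E.star {q : (Fin (m + k) → M) × (Fin (n + l) → N) |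
        g (q.1 ∘ Fin.castAdd k, q.2 ∘ Fin.castAdd l) = q.2 (Fin.natAdd n j)} =
      {q | E.starSnd g (q.1 ∘ Fin.castAdd k, q.2 ∘ Fin.castAdd l) = q.2 (Fin.natAdd n j)} := by
  have h := E.star_reindex (Fin.castAdd k : Fin m → Fin (m + k))
    (Fin.snoc (Fin.castAdd l) (Fin.natAdd n j) : Fin (n + 1) → Fin (n + l)) (graphSnd g)
  simp only [comp_snoc] at h
  simp only [starSnd_eq_iff, ← h]
  simp [graphSnd, eq_comm]

/-- Transfer for substitution of functions into a relation. -/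
theorem star_comp {m n k l : ℕ} (f : Fin k → (Fin m → M) × (Fin n → N) → M)
    (g : Fin l → (Fin m → M) × (Fin n → N) → N) (A : Set ((Fin k → M) × (Fin l → N))) :
    E.star {p | (fun i => f i p, fun j => g j p) ∈ A} =
      {a | (fun i => E.starFst (f i) a, fun j => E.starSnd (g j) a) ∈ E.star A} := by
  rw [comp_eq, E.star_exists, comp_eq, E.star_and, E.star_and, E.star_forall, E.star_forall,
    E.star_right]
  simp only [E.star_graph_fst, E.star_graph_snd]
  rfl

/-- Extension of functions commutes with composition. -/
theorem starFst_comp {m n k l : ℕ} (F : (Fin k → M) × (Fin l → N) → M)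
    (f : Fin k → (Fin m → M) × (Fin n → N) → M) (g : Fin l → (Fin m → M) × (Fin n → N) → N)
    (a : (Fin m → E.Fst) × (Fin n → E.Snd)) :
    E.starFst (fun p => F (fun i => f i p, fun j => g j p)) a =
      E.starFst F (fun i => E.starFst (f i) a, fun j => E.starSnd (g j) a) := by
  symm
  rw [starFst_eq_iff]
  have h := E.star_comp (Fin.snoc f (fun p => F (fun i => f i p, fun j => g j p)) :
    Fin (k + 1) → (Fin m → M) × (Fin n → N) → M) g (graphFst F)
  have h1 : {p | (fun i => (Fin.snoc f (fun p => F (fun i => f i p, fun j => g j p)) :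
    Fin (k + 1) → (Fin m → M) × (Fin n → N) → M) i p, fun j => g j p) ∈ graphFst F} =
      Set.univ := by
    refine Set.eq_univ_of_forall fun p => ?_
    simp [graphFst, Function.comp_def]
  rw [h1, E.star_univ] at h
  have h2 : a ∈ _ := h ▸ Set.mem_univ a
  rw [Set.mem_ofPred_eq] at h2
  convert h2 using 2
  funext i
  induction i using Fin.lastCases with
  | last => simp
  | cast i => simp

/-- Extension of functions commutes with composition. -/
theorem starSnd_comp {m n k l : ℕ} (F : (Fin k → M) × (Fin l → N) → N)
    (f : Fin k → (Fin m → M) × (Fin n → N) → M) (g : Fin l → (Fin m → M) × (Fin n → N) → N)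
    (a : (Fin m → E.Fst) × (Fin n → E.Snd)) :
    E.starSnd (fun p => F (fun i => f i p, fun j => g j p)) a =
      E.starSnd F (fun i => E.starFst (f i) a, fun j => E.starSnd (g j) a) :=
  E.swap.starFst_comp (fun p => F p.swap) (fun j p => g j p.swap) (fun i p => f i p.swap) a.swap

theorem starFst_proj {m n : ℕ} (i : Fin m) (a : (Fin m → E.Fst) × (Fin n → E.Snd)) :
    E.starFst (fun p => p.1 i) a = a.1 i := by
  rw [starFst_eq_iff]
  have h := E.star_eq_fst (n := n) (Fin.last m) i.castSucc
  have h' : graphFst (fun p : (Fin m → M) × (Fin n → N) => p.1 i) =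
    {p | p.1 (Fin.last m) = p.1 i.castSucc} := rfl
  rw [h', h]
  simp

theorem mem_star_eq_fst {m n : ℕ} (f g : (Fin m → M) × (Fin n → N) → M)
    (a : (Fin m → E.Fst) × (Fin n → E.Snd)) :
    a ∈ E.star {p | f p = g p} ↔ E.starFst f a = E.starFst g a := by
  have h := E.star_comp ![f, g] (Fin.elim0 : Fin 0 → _) {p | p.1 0 = p.1 1}
  rw [E.star_eq_fst] at h
  exact iff_of_eq (congrArg (a ∈ ·) h)

theorem starFst_const {m n m' n' : ℕ} (c : M) (a : (Fin m → E.Fst) × (Fin n → E.Snd))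
    (b : (Fin m' → E.Fst) × (Fin n' → E.Snd)) :
    E.starFst (fun _ => c) a = E.starFst (fun _ => c) b := by
  have h : ∀ {m n : ℕ} (a : (Fin m → E.Fst) × (Fin n → E.Snd)), E.starFst (fun _ => c) a =
      E.starFst (fun _ : (Fin 0 → M) × (Fin 0 → N) => c) (Fin.elim0, Fin.elim0) := by
    intro m n a
    refine (E.starFst_comp (fun _ : (Fin 0 → M) × (Fin 0 → N) => c) (fun i => i.elim0)
      (fun i => i.elim0) a).trans ?_
    congr 2
    all_goals exact Subsingleton.elim _ _
  rw [h a, h b]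

/-- The canonical embedding of `M` into `*M`. -/
noncomputable def coeFst (c : M) : E.Fst :=
  E.starFst (fun _ : (Fin 0 → M) × (Fin 0 → N) => c) (Fin.elim0, Fin.elim0)

/-- The canonical embedding of `N` into `*N`. -/
noncomputable def coeSnd (c : N) : E.Snd :=
  E.starSnd (fun _ : (Fin 0 → M) × (Fin 0 → N) => c) (Fin.elim0, Fin.elim0)

/-- The extension `*M → *M` of a function `M → M`. -/
noncomputable def mapFst (f : M → M) (x : E.Fst) : E.Fst :=
  E.starFst (fun p : (Fin 1 → M) × (Fin 0 → N) => f (p.1 0)) (![x], ![])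

/-- The extension `*M × *M → *M` of a function `M × M → M`. -/
noncomputable def mapFst₂ (f : M → M → M) (x y : E.Fst) : E.Fst :=
  E.starFst (fun p : (Fin 2 → M) × (Fin 0 → N) => f (p.1 0) (p.1 1)) (![x, y], ![])

/-- The extension `*N → *N` of a function `N → N`. -/
noncomputable def mapSnd (f : N → N) (y : E.Snd) : E.Snd :=
  E.starSnd (fun p : (Fin 0 → M) × (Fin 1 → N) => f (p.2 0)) (![], ![y])

/-- The extension `*M → *N` of a function `M → N`. -/
noncomputable def mapFstSnd (f : M → N) (x : E.Fst) : E.Snd :=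
  E.starSnd (fun p : (Fin 1 → M) × (Fin 0 → N) => f (p.1 0)) (![x], ![])

/-- The extension to `*N` of a binary relation on `N`. -/
def relSnd (r : N → N → Prop) (x y : E.Snd) : Prop :=
  (![], ![x, y]) ∈ E.star {p : (Fin 0 → M) × (Fin 2 → N) | r (p.2 0) (p.2 1)}

section Transfer

variable {m n : ℕ} (a : (Fin m → E.Fst) × (Fin n → E.Snd))

theorem coeFst_eq (c : M) : E.coeFst c = E.starFst (fun _ => c) a := E.starFst_const c _ _

theorem mapFst_starFst (F : M → M) (f : (Fin m → M) × (Fin n → N) → M) :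
    E.mapFst F (E.starFst f a) = E.starFst (fun p => F (f p)) a := by
  refine Eq.trans ?_ (E.starFst_comp (fun p : (Fin 1 → M) × (Fin 0 → N) => F (p.1 0)) ![f] ![] a).symm
  rw [mapFst]
  congr 2
  · funext i; fin_cases i; rfl
  · exact Subsingleton.elim _ _

theorem mapFst₂_starFst (F : M → M → M) (f g : (Fin m → M) × (Fin n → N) → M) :
    E.mapFst₂ F (E.starFst f a) (E.starFst g a) = E.starFst (fun p => F (f p) (g p)) a := by
  refine Eq.trans ?_
    (E.starFst_comp (fun p : (Fin 2 → M) × (Fin 0 → N) => F (p.1 0) (p.1 1)) ![f, g] ![] a).symm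
  rw [mapFst₂]
  congr 2
  · funext i; fin_cases i <;> rfl
  · exact Subsingleton.elim _ _

end Transfer

theorem exists_rep (x y w : E.Fst) : ∃ a : (Fin 3 → E.Fst) × (Fin 0 → E.Snd),
    x = E.starFst (fun p => p.1 0) a ∧ y = E.starFst (fun p => p.1 1) a ∧
      w = E.starFst (fun p => p.1 2) a :=
  ⟨(![x, y, w], ![]), by rw [starFst_proj]; rfl, by rw [starFst_proj]; rfl,
    by rw [starFst_proj]; rfl⟩

noncomputable instance instZeroFst [Zero M] : Zero E.Fst := ⟨E.coeFst 0⟩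

noncomputable instance instOneFst [One M] : One E.Fst := ⟨E.coeFst 1⟩

noncomputable instance instAddFst [Add M] : Add E.Fst := ⟨E.mapFst₂ (· + ·)⟩

noncomputable instance instMulFst [Mul M] : Mul E.Fst := ⟨E.mapFst₂ (· * ·)⟩

noncomputable instance instNegFst [Neg M] : Neg E.Fst := ⟨E.mapFst (- ·)⟩

noncomputable instance instInvFst [Inv M] : Inv E.Fst := ⟨E.mapFst (·⁻¹)⟩

/-- If `M` is a field, then `*M` is a field under the extended operations. -/
noncomputable instance instFieldFst [Field M] : Field E.Fst where
  nsmul := nsmulRec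
  zsmul := zsmulRec
  nnqsmul := _
  nnqsmul_def := fun _ _ => rfl
  qsmul := _
  qsmul_def := fun _ _ => rfl
  add_assoc x y w := by
    obtain ⟨a, rfl, rfl, rfl⟩ := E.exists_rep x y w
    change E.mapFst₂ _ (E.mapFst₂ _ _ _) _ = E.mapFst₂ _ _ (E.mapFst₂ _ _ _)
    simp only [mapFst₂_starFst, add_assoc]
  zero_add x := by
    obtain ⟨a, rfl, -, -⟩ := E.exists_rep x x x
    change E.mapFst₂ _ (E.coeFst 0) _ = _
    simp only [E.coeFst_eq a, mapFst₂_starFst, zero_add]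
  add_zero x := by
    obtain ⟨a, rfl, -, -⟩ := E.exists_rep x x x
    change E.mapFst₂ _ _ (E.coeFst 0) = _
    simp only [E.coeFst_eq a, mapFst₂_starFst, add_zero]
  add_comm x y := by
    obtain ⟨a, rfl, rfl, -⟩ := E.exists_rep x y x
    change E.mapFst₂ _ _ _ = E.mapFst₂ _ _ _
    simp only [mapFst₂_starFst, add_comm]
  neg_add_cancel x := by
    obtain ⟨a, rfl, -, -⟩ := E.exists_rep x x x
    change E.mapFst₂ _ (E.mapFst _ _) _ = E.coeFst 0
    simp only [E.coeFst_eq a, mapFst₂_starFst, mapFst_starFst, neg_add_cancel]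
  mul_assoc x y w := by
    obtain ⟨a, rfl, rfl, rfl⟩ := E.exists_rep x y w
    change E.mapFst₂ _ (E.mapFst₂ _ _ _) _ = E.mapFst₂ _ _ (E.mapFst₂ _ _ _)
    simp only [mapFst₂_starFst, mul_assoc]
  mul_comm x y := by
    obtain ⟨a, rfl, rfl, -⟩ := E.exists_rep x y x
    change E.mapFst₂ _ _ _ = E.mapFst₂ _ _ _
    simp only [mapFst₂_starFst, mul_comm]
  one_mul x := by
    obtain ⟨a, rfl, -, -⟩ := E.exists_rep x x x
    change E.mapFst₂ _ (E.coeFst 1) _ = _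
    simp only [E.coeFst_eq a, mapFst₂_starFst, one_mul]
  mul_one x := by
    obtain ⟨a, rfl, -, -⟩ := E.exists_rep x x x
    change E.mapFst₂ _ _ (E.coeFst 1) = _
    simp only [E.coeFst_eq a, mapFst₂_starFst, mul_one]
  zero_mul x := by
    obtain ⟨a, rfl, -, -⟩ := E.exists_rep x x x
    change E.mapFst₂ _ (E.coeFst 0) _ = E.coeFst 0
    simp only [E.coeFst_eq a, mapFst₂_starFst, zero_mul]
  mul_zero x := by
    obtain ⟨a, rfl, -, -⟩ := E.exists_rep x x x
    change E.mapFst₂ _ _ (E.coeFst 0) = E.coeFst 0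
    simp only [E.coeFst_eq a, mapFst₂_starFst, mul_zero]
  left_distrib x y w := by
    obtain ⟨a, rfl, rfl, rfl⟩ := E.exists_rep x y w
    change E.mapFst₂ _ _ (E.mapFst₂ _ _ _) = E.mapFst₂ _ (E.mapFst₂ _ _ _) (E.mapFst₂ _ _ _)
    simp only [mapFst₂_starFst, mul_add]
  right_distrib x y w := by
    obtain ⟨a, rfl, rfl, rfl⟩ := E.exists_rep x y w
    change E.mapFst₂ _ (E.mapFst₂ _ _ _) _ = E.mapFst₂ _ (E.mapFst₂ _ _ _) (E.mapFst₂ _ _ _)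
    simp only [mapFst₂_starFst, add_mul]
  exists_pair_ne := by
    let a : (Fin 0 → E.Fst) × (Fin 0 → E.Snd) := (![], ![])
    refine ⟨E.coeFst 0, E.coeFst 1, ?_⟩
    rw [E.coeFst_eq a, E.coeFst_eq a, Ne, ← mem_star_eq_fst]
    have h : {p : (Fin 0 → M) × (Fin 0 → N) | (0 : M) = 1} = ∅ := by simp
    rw [h, ← Set.sdiff_self (s := Set.univ), E.star_diff]
    simp
  inv_zero := by
    let a : (Fin 0 → E.Fst) × (Fin 0 → E.Snd) := (![], ![])
    change E.mapFst _ (E.coeFst 0) = E.coeFst 0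
    simp only [E.coeFst_eq a, mapFst_starFst, inv_zero]
  mul_inv_cancel x hx := by
    obtain ⟨a, rfl, -, -⟩ := E.exists_rep x x x
    change E.mapFst₂ _ _ (E.mapFst _ _) = E.coeFst 1
    change E.starFst _ a ≠ E.coeFst 0 at hx
    simp only [E.coeFst_eq a, mapFst₂_starFst, mapFst_starFst] at hx ⊢
    rw [Ne, ← mem_star_eq_fst] at hx
    rw [← mem_star_eq_fst]
    have h : {p : (Fin 3 → M) × (Fin 0 → N) | p.1 0 = 0} ∪
        {p | p.1 0 * (p.1 0)⁻¹ = 1} = Set.univ := by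
      refine Set.eq_univ_of_forall fun p => ?_
      by_cases h0 : p.1 0 = 0
      · exact Or.inl h0
      · exact Or.inr (mul_inv_cancel₀ h0)
    have h' : a ∈ _ := (h ▸ E.star_univ 3 0).symm ▸ Set.mem_univ a
    rw [E.star_union] at h'
    exact h'.resolve_left hx

/-- The finite elements of `*ℝ`: those `x` with `|x| < n` in `*ℝ` for some standard natural
number `n`. -/
def realFin {M : Type u} (E : NonstandardExtension.{u, 0, w} M ℝ) : Set E.Snd :=
  {x | ∃ n : ℕ, E.relSnd (· < ·) (E.mapSnd (fun r => |r|) x) (E.coeSnd (n : ℝ))}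

/-- Given `h : M → ℝ`, the set of elements `x` of `*M` whose (extended) height `h x ∈ *ℝ` is
finite. -/
def heightFin {M : Type u} (E : NonstandardExtension.{u, 0, w} M ℝ) (h : M → ℝ) : Set E.Fst :=
  {x | E.mapFstSnd h x ∈ E.realFin}

end NonstandardExtension

/-!
The heights of `x + y`, `x * y` and `x⁻¹` are bounded in terms of those of `x` and `y`, and, place
by place, a root of a monic polynomial of degree `n` has height at most `log n` plus the sum of
the heights of the coefficients. For a fixed `n` the bound depends only on a bound for the heights
of the arguments, so finiteness of the height transfers: the elements of finite height form a
subfield `L` of `*K` that contains all roots in `*K` of monic polynomials over `L`. Since the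
solvable monic equations of degree `n` form a projection of the set of pairs of an equation and a
solution, algebraic closedness passes from `K` to `*K`, and a relatively algebraically closed
subfield of an algebraically closed field is algebraically closed.
-/

section NumberFieldHeight

open NumberField Height Module

variable {k K : Type*} [Field k] [NumberField k] [Field K] [NumberField K]

theorem prod_infinitePlace_pow_mult_eq_prod_embeddings {M : Type*} [CommMonoid M]
    (f : InfinitePlace K → M) :
    ∏ w : InfinitePlace K, f w ^ w.mult = ∏ φ : K →+* ℂ, f (InfinitePlace.mk φ) := by
  classical
  rw [← Finset.prod_fiberwise Finset.univ InfinitePlace.mk fun φ : K →+* ℂ => f (.mk φ)]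
  refine Finset.prod_congr rfl fun w _ => ?_
  rw [← InfinitePlace.card_filter_mk_eq w, ← Finset.prod_const]
  exact Finset.prod_congr rfl fun φ hφ => by rw [(Finset.mem_filter.mp hφ).2]

theorem card_filter_embedding_comp_algebraMap_eq [Algebra k K] (ψ : k →+* ℂ)
    [DecidablePred fun φ : K →+* ℂ => φ.comp (algebraMap k K) = ψ] :
    (Finset.univ.filter fun φ : K →+* ℂ => φ.comp (algebraMap k K) = ψ).card = finrank k K := by
  let _ := ψ.toAlgebra
  rw [← AlgHom.card k K ℂ, ← Fintype.card_subtype]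
  exact Fintype.card_congr
    { toFun := fun φ => { φ.1 with commutes' := fun r => RingHom.congr_fun φ.2 r }
      invFun := fun φ => ⟨φ.toRingHom, φ.comp_algebraMap⟩
      left_inv := fun _ => rfl
      right_inv := fun _ => rfl }

theorem prod_infinitePlace_comap_pow_mult {M : Type*} [CommMonoid M] [Algebra k K]
    (f : InfinitePlace k → M) :
    ∏ w : InfinitePlace K, f (w.comap (algebraMap k K)) ^ w.mult =
      (∏ v : InfinitePlace k, f v ^ v.mult) ^ finrank k K := by
  classical
  rw [prod_infinitePlace_pow_mult_eq_prod_embeddings f,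
    prod_infinitePlace_pow_mult_eq_prod_embeddings
      fun w : InfinitePlace K => f (w.comap (algebraMap k K)),
    ← Finset.prod_fiberwise Finset.univ fun φ : K →+* ℂ => φ.comp (algebraMap k K),
    ← Finset.prod_pow]
  refine Finset.prod_congr rfl fun ψ _ => ?_
  rw [← card_filter_embedding_comp_algebraMap_eq (K := K) ψ, ← Finset.prod_const]
  refine Finset.prod_congr rfl fun φ hφ => ?_
  rw [InfinitePlace.comap_mk, (Finset.mem_filter.mp hφ).2]

theorem mulHeight_mul_absNorm_span {ι : Type*} [Finite ι] {x : ι → 𝓞 K} (hx : x ≠ 0) :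
    mulHeight (fun i => (x i : K)) * (Ideal.span (Set.range x)).absNorm =
      ∏ v : InfinitePlace K, (⨆ i, v (x i)) ^ v.mult := by
  have hx' : (fun i => (x i : K)) ≠ 0 := fun h =>
    hx (funext fun i => RingOfIntegers.ext (congrFun h i))
  rw [NumberField.mulHeight_eq hx', mul_assoc, mul_comm (finprod _),
    absNorm_mul_finprod_finitePlace_eq_one hx, mul_one]

theorem mulHeight_algebraMap_ringOfIntegers [Algebra k K] {ι : Type*} [Finite ι]
    {x : ι → 𝓞 k} (hx : x ≠ 0) :
    mulHeight (fun i => algebraMap k K (x i)) = mulHeight (fun i => (x i : k)) ^ finrank k K := by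
  let y : ι → 𝓞 K := fun i => algebraMap (𝓞 k) (𝓞 K) (x i)
  have hy : y ≠ 0 := fun h => hx <| funext fun i =>
    FaithfulSMul.algebraMap_injective (𝓞 k) (𝓞 K) <| (congrFun h i).trans (map_zero _).symm
  have hspan : Ideal.span (Set.range y) =
      (Ideal.span (Set.range x)).map (algebraMap (𝓞 k) (𝓞 K)) := by
    rw [Ideal.map_span, ← Set.range_comp]
    rfl
  have habsNorm : (Ideal.span (Set.range y)).absNorm =
      (Ideal.span (Set.range x)).absNorm ^ finrank k K := by
    rw [hspan, Ideal.absNorm_algebraMap, ← IsFractionRing.finrank_eq (𝓞 k) k (𝓞 K) K]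
  have habsNorm_ne : (((Ideal.span (Set.range x)).absNorm : ℝ)) ≠ 0 := by
    rw [Nat.cast_ne_zero, Ne, Ideal.absNorm_eq_zero_iff, Ideal.span_eq_bot]
    contrapose! hx
    exact funext fun i => hx _ ⟨i, rfl⟩
  have hinf : ∏ w : InfinitePlace K, (⨆ i, w (y i)) ^ w.mult =
      (∏ v : InfinitePlace k, (⨆ i, v (x i)) ^ v.mult) ^ finrank k K :=
    prod_infinitePlace_comap_pow_mult fun v : InfinitePlace k => ⨆ i, v (x i)
  rw [← mulHeight_mul_absNorm_span hx, ← mulHeight_mul_absNorm_span hy, habsNorm, mul_pow,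
    Nat.cast_pow] at hinf
  exact mul_right_cancel₀ (pow_ne_zero _ habsNorm_ne) hinf

theorem mulHeight_algebraMap [Algebra k K] {ι : Type*} [Finite ι] (x : ι → k) :
    mulHeight (fun i => algebraMap k K (x i)) = mulHeight x ^ finrank k K := by
  rcases eq_or_ne x 0 with rfl | hx
  · simp [← Pi.zero_def]
  obtain ⟨b, hb⟩ := IsLocalization.exist_integer_multiples_of_finite (nonZeroDivisors (𝓞 k)) x
  choose y hy using hb
  have hb0 : ((b : 𝓞 k) : k) ≠ 0 :=
    RingOfIntegers.coe_ne_zero_iff.mpr (nonZeroDivisors.coe_ne_zero b)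
  have hyx : (fun i => (y i : k)) = ((b : 𝓞 k) : k) • x :=
    funext fun i => (hy i).trans (Algebra.smul_def _ _)
  have hy0 : y ≠ 0 := by
    rintro rfl
    refine smul_ne_zero hb0 hx (hyx.symm.trans ?_)
    exact funext fun _ => map_zero _
  have hyx' : (fun i => algebraMap k K (y i)) =
      algebraMap k K (b : 𝓞 k) • fun i => algebraMap k K (x i) :=
    funext fun i => (congrArg (algebraMap k K) (congrFun hyx i)).trans (map_mul _ _ _)
  have h := mulHeight_algebraMap_ringOfIntegers (K := K) hy0
  rwa [hyx, hyx', mulHeight_smul_eq_mulHeight _ hb0,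
    mulHeight_smul_eq_mulHeight _ ((map_ne_zero _).mpr hb0)] at h

theorem logHeight₁_algebraMap [Algebra k K] (x : k) :
    logHeight₁ (algebraMap k K x) = finrank k K * logHeight₁ x := by
  have h : (fun i => algebraMap k K (![x, 1] i)) = ![algebraMap k K x, 1] := by
    ext i; fin_cases i <;> simp
  rw [logHeight₁_eq_log_mulHeight₁, logHeight₁_eq_log_mulHeight₁, mulHeight₁_eq_mulHeight,
    mulHeight₁_eq_mulHeight, ← h, mulHeight_algebraMap, Real.log_pow]

theorem logHeight₁_map_div_finrank (f : k →+* K) (x : k) :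
    logHeight₁ (f x) / finrank ℚ K = logHeight₁ x / finrank ℚ k := by
  let _ := f.toAlgebra
  have : Module.Finite k K := Module.Finite.of_restrictScalars_finite ℚ k K
  have hK : (finrank k K : ℝ) ≠ 0 := Nat.cast_ne_zero.mpr finrank_pos.ne'
  rw [← f.algebraMap_toAlgebra, logHeight₁_algebraMap, ← finrank_mul_finrank ℚ k K, Nat.cast_mul,
    mul_comm (finrank ℚ k : ℝ), mul_div_mul_left _ _ hK]

end NumberFieldHeight

section MonicRoot

variable {R S : Type*}

/-- `x` is a root of the monic polynomial `X ^ n + a_{n-1} X ^ (n-1) + ⋯ + a_0`, presented by the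
tuple of its nonleading coefficients so that it can be transferred to nonstandard extensions. -/
def IsMonicRoot [Semiring R] {n : ℕ} (a : Fin n → R) (x : R) : Prop :=
  x ^ n + ∑ i, a i * x ^ (i : ℕ) = 0

open Polynomial in
theorem isMonicRoot_coeff_iff [CommSemiring R] [Semiring S] [Algebra R S] {p : R[X]}
    (hp : p.Monic) {x : S} :
    IsMonicRoot (fun i : Fin p.natDegree => algebraMap R S (p.coeff i)) x ↔ aeval x p = 0 := by
  have h : aeval x p = x ^ p.natDegree +
      ∑ i : Fin p.natDegree, algebraMap R S (p.coeff i) * x ^ (i : ℕ) := by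
    conv_lhs => rw [hp.as_sum]
    simp [Finset.sum_range]
  rw [h, IsMonicRoot]

open Polynomial in
theorem exists_isMonicRoot [Field R] [IsAlgClosed R] {n : ℕ} (hn : n ≠ 0) (a : Fin n → R) :
    ∃ x, IsMonicRoot a x := by
  have hdeg : (X ^ n + ∑ i : Fin n, C (a i) * X ^ (i : ℕ)).degree = n := by
    rw [degree_add_eq_left_of_degree_lt, degree_X_pow]
    exact (degree_sum_fin_lt a).trans_eq (degree_X_pow n).symm
  obtain ⟨x, hx⟩ := IsAlgClosed.exists_root _ (hdeg.trans_ne (Nat.cast_ne_zero.mpr hn))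
  exact ⟨x, by simpa [IsMonicRoot, IsRoot, eval_finsetSum] using hx⟩

theorem IsMonicRoot.ne_zero [Semiring R] [Nontrivial R] {n : ℕ} {a : Fin n → R} {x : R}
    (h : IsMonicRoot a x) : n ≠ 0 := by
  rintro rfl
  simp [IsMonicRoot] at h

theorem IsMonicRoot.of_map [Semiring R] [Semiring S] {f : R →+* S} (hf : Function.Injective f)
    {n : ℕ} {a : Fin n → R} {x : R} (h : IsMonicRoot (fun i => f (a i)) (f x)) :
    IsMonicRoot a x :=
  hf (by simpa [IsMonicRoot] using h)

section RootBound

open Height AdmissibleAbsValues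

variable {K : Type*} [Field K] {n : ℕ} {a : Fin n → K} {x : K}

theorem max_abv_one_le_of_pow_le (v : AbsoluteValue K ℝ) {C : ℝ} (hC : 1 ≤ C) (hn : n ≠ 0)
    (h : 1 ≤ v x → v (x ^ n) ≤ C * v x ^ (n - 1)) : max (v x) 1 ≤ C := by
  refine max_le ?_ hC
  rcases le_or_gt (v x) 1 with hx | hx
  · exact hx.trans hC
  · have h' := h hx.le
    rw [map_pow, ← mul_pow_sub_one hn] at h'
    exact le_of_mul_le_mul_right h' (by positivity)

theorem abv_mul_pow_le (v : AbsoluteValue K ℝ) (a : Fin n → K) (hx : 1 ≤ v x) (i : Fin n) :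
    v (a i * x ^ (i : ℕ)) ≤ (∏ i, max (v (a i)) 1) * v x ^ (n - 1) := by
  rw [map_mul, map_pow]
  gcongr
  · exact Finset.le_prod_max_one (Finset.mem_univ i) fun i => v (a i)
  · exact Nat.le_sub_one_of_lt i.2

theorem IsMonicRoot.abv_pow_eq (v : AbsoluteValue K ℝ) (h : IsMonicRoot a x) :
    v (x ^ n) = v (∑ i, a i * x ^ (i : ℕ)) := by
  rw [eq_neg_of_add_eq_zero_left h, v.map_neg]

theorem IsMonicRoot.max_abv_one_le (v : AbsoluteValue K ℝ) (h : IsMonicRoot a x) :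
    max (v x) 1 ≤ n * ∏ i, max (v (a i)) 1 := by
  have hprod : 1 ≤ ∏ i, max (v (a i)) 1 := Finset.univ.one_le_prod fun _ _ => le_max_right ..
  have hn : (1 : ℝ) ≤ n := Nat.one_le_cast.mpr (Nat.one_le_iff_ne_zero.mpr h.ne_zero)
  refine max_abv_one_le_of_pow_le v (one_le_mul_of_one_le_of_one_le hn hprod) h.ne_zero
    fun hx => ?_
  calc v (x ^ n) = v (∑ i, a i * x ^ (i : ℕ)) := h.abv_pow_eq v
    _ ≤ ∑ i, v (a i * x ^ (i : ℕ)) := v.sum_le _ _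
    _ ≤ ∑ _i : Fin n, (∏ i, max (v (a i)) 1) * v x ^ (n - 1) :=
      Finset.sum_le_sum fun i _ => abv_mul_pow_le v a hx i
    _ = n * (∏ i, max (v (a i)) 1) * v x ^ (n - 1) := by simp [mul_assoc]

theorem IsMonicRoot.max_abv_one_le_of_isNonarchimedean {v : AbsoluteValue K ℝ}
    (hv : IsNonarchimedean v) (h : IsMonicRoot a x) : max (v x) 1 ≤ ∏ i, max (v (a i)) 1 := by
  have hprod : 1 ≤ ∏ i, max (v (a i)) 1 := Finset.univ.one_le_prod fun _ _ => le_max_right ..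
  have : Nonempty (Fin n) := Fin.pos_iff_nonempty.mp h.ne_zero.pos
  refine max_abv_one_le_of_pow_le v hprod h.ne_zero fun hx => ?_
  rw [h.abv_pow_eq v]
  exact (hv.apply_sum_le_sup Finset.univ_nonempty).trans
    (Finset.sup'_le _ _ fun i _ => abv_mul_pow_le v a hx i)

variable [AdmissibleAbsValues K]

open Finset Multiset in
theorem IsMonicRoot.mulHeight₁_le (h : IsMonicRoot a x) :
    mulHeight₁ x ≤ n ^ totalWeight K * ∏ i, mulHeight₁ (a i) := by
  simp only [mulHeight₁_eq, totalWeight]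
  rw [prod_mul_distrib, ← prod_replicate, ← map_const, ← finprod_prod_comm _ _ (by fun_prop),
    ← prod_map_prod, ← mul_assoc, ← prod_map_mul]
  simp only [Function.const_apply]
  gcongr
  · exact finprod_nonneg fun _ => by positivity
  · exact prod_map_nonneg fun _ _ => by positivity
  · exact prod_map_le_prod_map₀ _ _ (fun _ _ => by positivity) fun v _ => h.max_abv_one_le v
  · exact finprod_le_finprod (by fun_prop) (fun _ => by positivity) (by fun_prop) <|
      fun v => h.max_abv_one_le_of_isNonarchimedean (isNonarchimedean _ v.prop)

theorem IsMonicRoot.logHeight₁_le (h : IsMonicRoot a x) :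
    logHeight₁ x ≤ totalWeight K * Real.log n + ∑ i, logHeight₁ (a i) := by
  have hn : (n : ℝ) ≠ 0 := Nat.cast_ne_zero.mpr h.ne_zero
  simp only [logHeight₁_eq_log_mulHeight₁]
  rw [← Real.log_prod fun _ _ => mulHeight₁_ne_zero _, ← Real.log_pow,
    ← Real.log_mul (pow_ne_zero _ hn) (Finset.prod_ne_zero_iff.mpr fun _ _ => mulHeight₁_ne_zero _)]
  exact Real.log_le_log (mulHeight₁_pos _) h.mulHeight₁_le

end RootBound

end MonicRoot

section AbsoluteHeight

open NumberField Height Module IntermediateField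

variable {K : Type*} [Field K] [CharZero K]

theorem absLogHeight₁_coe (F : IntermediateField ℚ K) [NumberField F] (x : F) :
    absLogHeight₁ (x : K) = logHeight₁ x / finrank ℚ F := by
  have hx : IsIntegral ℚ (x : K) := (IsIntegral.of_finite ℚ x).map F.val
  have : FiniteDimensional ℚ ℚ⟮(x : K)⟯ := adjoin.finiteDimensional hx
  have : NumberField ℚ⟮(x : K)⟯ := {}
  have hle : ℚ⟮(x : K)⟯ ≤ F := adjoin_simple_le_iff.mpr x.2
  have hgen : (inclusion hle).toRingHom (AdjoinSimple.gen ℚ (x : K)) = x := rfl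
  rw [← hgen, logHeight₁_map_div_finrank, hgen, absLogHeight₁, absMulHeight₁, dif_pos hx,
    Real.log_rpow (mulHeight₁_pos _), logHeight₁_eq_log_mulHeight₁, div_eq_inv_mul]

variable [Algebra.IsAlgebraic ℚ K]

theorem exists_numberField_superset {s : Set K} (hs : s.Finite) :
    ∃ F : IntermediateField ℚ K, NumberField F ∧ s ⊆ F := by
  have : Finite s := hs
  have : FiniteDimensional ℚ (adjoin ℚ s) :=
    finiteDimensional_adjoin fun x _ => Algebra.IsIntegral.isIntegral x
  exact ⟨adjoin ℚ s, {}, subset_adjoin ℚ s⟩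

theorem absLogHeight₁_nonneg (x : K) : 0 ≤ absLogHeight₁ x := by
  obtain ⟨F, _, hF⟩ := exists_numberField_superset (Set.finite_singleton x)
  lift x to F using hF (Set.mem_singleton x)
  rw [absLogHeight₁_coe]
  exact div_nonneg (zero_le_logHeight₁ x) (Nat.cast_nonneg _)

theorem absLogHeight₁_add_le (x y : K) :
    absLogHeight₁ (x + y) ≤ Real.log 2 + absLogHeight₁ x + absLogHeight₁ y := by
  obtain ⟨F, _, hF⟩ := exists_numberField_superset (Set.toFinite {x, y})
  lift x to F using hF (by simp)
  lift y to F using hF (by simp)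
  have hd : (0 : ℝ) < finrank ℚ F := Nat.cast_pos.mpr finrank_pos
  have h := logHeight₁_add_le x y
  rw [totalWeight_eq_finrank] at h
  rw [← F.coe_add, absLogHeight₁_coe, absLogHeight₁_coe, absLogHeight₁_coe, div_le_iff₀ hd]
  field_simp
  linarith

theorem absLogHeight₁_mul_le (x y : K) :
    absLogHeight₁ (x * y) ≤ absLogHeight₁ x + absLogHeight₁ y := by
  obtain ⟨F, _, hF⟩ := exists_numberField_superset (Set.toFinite {x, y})
  lift x to F using hF (by simp)
  lift y to F using hF (by simp)
  rw [← F.coe_mul, absLogHeight₁_coe, absLogHeight₁_coe, absLogHeight₁_coe, ← add_div]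
  gcongr
  exact logHeight₁_mul_le x y

theorem absLogHeight₁_inv (x : K) : absLogHeight₁ x⁻¹ = absLogHeight₁ x := by
  obtain ⟨F, _, hF⟩ := exists_numberField_superset (Set.finite_singleton x)
  lift x to F using hF (Set.mem_singleton x)
  rw [← F.coe_inv, absLogHeight₁_coe, absLogHeight₁_coe, logHeight₁_inv]

theorem IsMonicRoot.absLogHeight₁_le {n : ℕ} {a : Fin n → K} {x : K} (h : IsMonicRoot a x) :
    absLogHeight₁ x ≤ Real.log n + ∑ i, absLogHeight₁ (a i) := by
  obtain ⟨F, _, hF⟩ := exists_numberField_superset ((Set.finite_range a).insert x)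
  lift x to F using hF (Set.mem_insert _ _)
  lift a to Fin n → F using fun i => hF (Set.mem_insert_of_mem _ ⟨i, rfl⟩)
  have hd : (0 : ℝ) < finrank ℚ F := Nat.cast_pos.mpr finrank_pos
  have hroot : IsMonicRoot a x := .of_map (f := algebraMap F K) Subtype.val_injective h
  have hle := hroot.logHeight₁_le
  rw [totalWeight_eq_finrank] at hle
  simp only [absLogHeight₁_coe]
  rw [← Finset.sum_div, div_le_iff₀ hd, add_mul, div_mul_cancel₀ _ hd.ne', mul_comm (Real.log n)]
  exact hle

end AbsoluteHeight

/-- A real-valued function on a field that behaves qualitatively like a height: the field operations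
and the passage to a root of a monic polynomial of given degree preserve boundedness. -/
structure IsHeightLike {K : Type*} [Field K] (h : K → ℝ) : Prop where
  add : ∀ B : ℝ, ∃ C : ℝ, ∀ x y, |h x| ≤ B → |h y| ≤ B → |h (x + y)| ≤ C
  mul : ∀ B : ℝ, ∃ C : ℝ, ∀ x y, |h x| ≤ B → |h y| ≤ B → |h (x * y)| ≤ C
  inv : ∀ B : ℝ, ∃ C : ℝ, ∀ x, |h x| ≤ B → |h x⁻¹| ≤ C
  root : ∀ (n : ℕ) (B : ℝ), ∃ C : ℝ, ∀ (a : Fin n → K) (x : K), IsMonicRoot a x →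
    (∀ i, |h (a i)| ≤ B) → |h x| ≤ C

theorem IsHeightLike.neg {K : Type*} [Field K] {h : K → ℝ} (hh : IsHeightLike h) (B : ℝ) :
    ∃ C : ℝ, ∀ x, |h x| ≤ B → |h (-x)| ≤ C := by
  obtain ⟨C, hC⟩ := hh.mul (max B |h (-1)|)
  exact ⟨C, fun x hx => neg_one_mul x ▸ hC _ _ (le_max_right ..) (hx.trans (le_max_left ..))⟩

theorem isHeightLike_absLogHeight₁ (K : Type*) [Field K] [CharZero K] [Algebra.IsAlgebraic ℚ K] :
    IsHeightLike (NumberField.absLogHeight₁ (K := K)) where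
  add B := ⟨Real.log 2 + B + B, fun x y => by
    simp only [abs_of_nonneg (absLogHeight₁_nonneg _)]
    intro hx hy
    linarith [absLogHeight₁_add_le x y]⟩
  mul B := ⟨B + B, fun x y => by
    simp only [abs_of_nonneg (absLogHeight₁_nonneg _)]
    exact fun hx hy => (absLogHeight₁_mul_le x y).trans (add_le_add hx hy)⟩
  inv B := ⟨B, fun x hx => by rwa [absLogHeight₁_inv]⟩
  root n B := ⟨Real.log n + n * B, fun a x hroot => by
    simp only [abs_of_nonneg (absLogHeight₁_nonneg _)]
    intro ha
    refine hroot.absLogHeight₁_le.trans (add_le_add_right ?_ _)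
    simpa using Finset.sum_le_card_nsmul Finset.univ _ B fun i _ => ha i⟩

namespace NonstandardExtension

section Transfer

variable {M : Type u} {N : Type v} (E : NonstandardExtension.{u, v, w} M N) {m n : ℕ}
  (a : (Fin m → E.Fst) × (Fin n → E.Snd))

theorem mapFstSnd_starFst (F : M → N) (f : (Fin m → M) × (Fin n → N) → M) :
    E.mapFstSnd F (E.starFst f a) = E.starSnd (fun p => F (f p)) a := by
  refine Eq.trans ?_
    (E.starSnd_comp (fun p : (Fin 1 → M) × (Fin 0 → N) => F (p.1 0)) ![f] ![] a).symm
  rw [mapFstSnd]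
  congr 2
  · funext i; fin_cases i; rfl
  · exact Subsingleton.elim _ _

theorem mapSnd_starSnd (F : N → N) (g : (Fin m → M) × (Fin n → N) → N) :
    E.mapSnd F (E.starSnd g a) = E.starSnd (fun p => F (g p)) a :=
  E.swap.mapFst_starFst a.swap F fun p => g p.swap

theorem relSnd_starSnd_iff (r : N → N → Prop) (f g : (Fin m → M) × (Fin n → N) → N) :
    E.relSnd r (E.starSnd f a) (E.starSnd g a) ↔ a ∈ E.star {p | r (f p) (g p)} := by
  have hcomp := E.star_comp (Fin.elim0 : Fin 0 → _) ![f, g] {p | r (p.2 0) (p.2 1)}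
  refine Iff.trans (iff_of_eq ?_) (iff_of_eq (congrArg (a ∈ ·) hcomp)).symm
  refine congrArg (· ∈ E.star _) (Prod.ext (Subsingleton.elim _ _) ?_)
  funext j
  fin_cases j <;> rfl

/-- Evaluation of the extensions of functions at a point of the extension. -/
noncomputable def starFstHom [Field M] : ((Fin m → M) × (Fin n → N) → M) →+* E.Fst where
  toFun f := E.starFst f a
  map_one' := (E.coeFst_eq a 1).symm
  map_zero' := (E.coeFst_eq a 0).symm
  map_mul' f g := (E.mapFst₂_starFst a (· * ·) f g).symm
  map_add' f g := (E.mapFst₂_starFst a (· + ·) f g).symm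

end Transfer

section MonicRootSet

/-- The relation `IsMonicRoot a x` as a set of tuples `(a, x)`, in the form to which nonstandard
extensions apply: there are no coordinates of the second sort. -/
def monicRootSet (R : Type*) [Semiring R] (S : Type*) (n : ℕ) :
    Set ((Fin (n + 1) → R) × (Fin 0 → S)) :=
  {p | IsMonicRoot (p.1 ∘ Fin.castSucc) (p.1 (Fin.last n))}

variable {K : Type u} [Field K] {N : Type v} (E : NonstandardExtension.{u, v, w} K N)

theorem star_monicRootSet (n : ℕ) :
    E.star (monicRootSet K N n) = monicRootSet E.Fst E.Snd n := by
  ext a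
  let coord (i : Fin (n + 1)) : (Fin (n + 1) → K) × (Fin 0 → N) → K := fun p => p.1 i
  let poly := coord (Fin.last n) ^ n + ∑ i : Fin n, coord i.castSucc * coord (Fin.last n) ^ (i : ℕ)
  have hpoly : monicRootSet K N n = {p | poly p = (0 : (Fin (n + 1) → K) × (Fin 0 → N) → K) p} := by
    ext p
    simp [monicRootSet, IsMonicRoot, poly, coord]
  have hcoord (i : Fin (n + 1)) : E.starFstHom a (coord i) = a.1 i := E.starFst_proj i a
  rw [hpoly, mem_star_eq_fst]
  change E.starFstHom a poly = E.starFstHom a 0 ↔ _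
  simp [poly, hcoord, monicRootSet, IsMonicRoot]

theorem exists_isMonicRoot_fst [IsAlgClosed K] {n : ℕ} (hn : n ≠ 0) (b : Fin n → E.Fst) :
    ∃ y, IsMonicRoot b y := by
  have hproj : (fun p => (p.1 ∘ Fin.castSucc, p.2)) '' monicRootSet K N n = Set.univ := by
    refine Set.eq_univ_of_forall fun p => ?_
    obtain ⟨x, hx⟩ := exists_isMonicRoot hn p.1
    exact ⟨(Fin.snoc p.1 x, p.2), by simpa [monicRootSet, snoc_comp] using hx, by simp⟩
  have hstar := E.star_proj_fst (monicRootSet K N n)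
  rw [hproj, E.star_univ, star_monicRootSet] at hstar
  obtain ⟨q, hq, hqb⟩ := hstar.subset (Set.mem_univ (b, ![]))
  obtain rfl := congrArg Prod.fst hqb
  exact ⟨_, hq⟩

instance instIsAlgClosedFst [IsAlgClosed K] : IsAlgClosed E.Fst := by
  refine IsAlgClosed.of_exists_root _ fun p hp hirr => ?_
  obtain ⟨y, hy⟩ := E.exists_isMonicRoot_fst hirr.natDegree_pos.ne' fun i => p.coeff i
  exact ⟨y, by simpa using (isMonicRoot_coeff_iff hp).mp hy⟩

end MonicRootSet

section HeightFin

variable {M : Type u} (E : NonstandardExtension.{u, 0, w} M ℝ) (h : M → ℝ) {m n : ℕ}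

theorem apply_mem_heightFin_iff (a : (Fin m → E.Fst) × (Fin n → E.Snd)) (j : Fin m) :
    a.1 j ∈ E.heightFin h ↔ ∃ k : ℕ, a ∈ E.star {p | |h (p.1 j)| < k} := by
  refine exists_congr fun k => ?_
  have hk : E.coeSnd (k : ℝ) = E.starSnd (fun _ => (k : ℝ)) a := E.swap.coeFst_eq a.swap (k : ℝ)
  rw [← E.starFst_proj j a, mapFstSnd_starFst, mapSnd_starSnd, hk, relSnd_starSnd_iff]

variable {E h}

theorem last_mem_heightFin {A : Set ((Fin (m + 1) → M) × (Fin n → ℝ))}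
    (bound : ∀ B : ℝ, ∃ C : ℝ, ∀ p ∈ A, (∀ i : Fin m, |h (p.1 i.castSucc)| ≤ B) →
      |h (p.1 (Fin.last m))| ≤ C)
    {a : (Fin (m + 1) → E.Fst) × (Fin n → E.Snd)} (ha : a ∈ E.star A)
    (hfin : ∀ i : Fin m, a.1 i.castSucc ∈ E.heightFin h) :
    a.1 (Fin.last m) ∈ E.heightFin h := by
  choose k hk using fun i => (E.apply_mem_heightFin_iff h a (Fin.castSucc i)).mp (hfin i)
  obtain ⟨C, hC⟩ := bound (∑ i, k i : ℕ)
  obtain ⟨c, hc⟩ := exists_nat_gt C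
  rw [apply_mem_heightFin_iff]
  have hsub : A ∩ {p | ∀ i : Fin m, |h (p.1 i.castSucc)| < k i} ⊆
      {p | |h (p.1 (Fin.last m))| < c} := by
    rintro p ⟨hpA, hp⟩
    refine (hC p hpA fun i => (hp i).le.trans ?_).trans_lt hc
    exact Nat.cast_le.mpr (Finset.single_le_sum (fun _ _ => Nat.zero_le _) (Finset.mem_univ i))
  have hmem := E.star_mono hsub
  rw [star_inter, star_forall] at hmem
  exact ⟨c, hmem ⟨ha, hk⟩⟩

theorem starFst_mem_heightFin {f : (Fin m → M) × (Fin n → ℝ) → M}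
    (bound : ∀ B : ℝ, ∃ C : ℝ, ∀ p, (∀ i, |h (p.1 i)| ≤ B) → |h (f p)| ≤ C)
    {a : (Fin m → E.Fst) × (Fin n → E.Snd)} (hfin : ∀ i, a.1 i ∈ E.heightFin h) :
    E.starFst f a ∈ E.heightFin h := by
  have hgraph := (E.starFst_eq_iff f a _).mp rfl
  have hlast := last_mem_heightFin (A := graphFst f) (h := h) (fun B => ?_) hgraph (by simpa)
  · simpa using hlast
  · obtain ⟨C, hC⟩ := bound B
    refine ⟨C, fun p hp hB => ?_⟩
    rw [show p.1 (Fin.last m) = _ from hp]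
    exact hC _ hB

theorem coeFst_mem_heightFin (c : M) : E.coeFst c ∈ E.heightFin h :=
  starFst_mem_heightFin (fun _ => ⟨|h c|, fun _ _ => le_rfl⟩) fun i => i.elim0

theorem mapFst_mem_heightFin {f : M → M}
    (bound : ∀ B : ℝ, ∃ C : ℝ, ∀ x, |h x| ≤ B → |h (f x)| ≤ C) {x : E.Fst}
    (hx : x ∈ E.heightFin h) : E.mapFst f x ∈ E.heightFin h :=
  starFst_mem_heightFin
    (fun B => (bound B).imp fun _ hC p hp => hC (p.1 0) (hp 0)) (Fin.forall_fin_one.mpr hx)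

theorem mapFst₂_mem_heightFin {f : M → M → M}
    (bound : ∀ B : ℝ, ∃ C : ℝ, ∀ x y, |h x| ≤ B → |h y| ≤ B → |h (f x y)| ≤ C) {x y : E.Fst}
    (hx : x ∈ E.heightFin h) (hy : y ∈ E.heightFin h) : E.mapFst₂ f x y ∈ E.heightFin h :=
  starFst_mem_heightFin
    (fun B => (bound B).imp fun _ hC p hp => hC (p.1 0) (p.1 1) (hp 0) (hp 1))
    (Fin.forall_fin_two.mpr ⟨hx, hy⟩)

end HeightFin

section HeightFinSubfield

variable {K : Type u} [Field K] (E : NonstandardExtension.{u, 0, w} K ℝ) {h : K → ℝ}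

theorem mem_heightFin_of_isMonicRoot (hh : IsHeightLike h) {n : ℕ} {a : Fin n → E.Fst}
    {x : E.Fst} (hroot : IsMonicRoot a x) (ha : ∀ i, a i ∈ E.heightFin h) : x ∈ E.heightFin h := by
  have hmem : (Fin.snoc a x, ![]) ∈ E.star (monicRootSet K ℝ n) := by
    rw [star_monicRootSet]
    simpa [monicRootSet, snoc_comp] using hroot
  simpa using last_mem_heightFin (fun B => (hh.root n B).imp fun _ hC p => hC _ _) hmem (by simpa)

/-- The subfield of elements of finite height of `*K`, for a height-like function on `K`. -/
def heightFinSubfield (hh : IsHeightLike h) : Subfield E.Fst where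
  carrier := E.heightFin h
  mul_mem' := mapFst₂_mem_heightFin hh.mul
  one_mem' := coeFst_mem_heightFin 1
  add_mem' := mapFst₂_mem_heightFin hh.add
  zero_mem' := coeFst_mem_heightFin 0
  neg_mem' := mapFst_mem_heightFin hh.neg
  inv_mem' _ := mapFst_mem_heightFin hh.inv

theorem algebraicClosure_heightFinSubfield_eq_bot (hh : IsHeightLike h) :
    algebraicClosure (E.heightFinSubfield hh) E.Fst = ⊥ := by
  refine eq_bot_iff.mpr fun x hx => ?_
  have hint : IsIntegral (E.heightFinSubfield hh) x := mem_algebraicClosure_iff'.mp hx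
  have hroot := (isMonicRoot_coeff_iff (minpoly.monic hint)).mpr (minpoly.aeval _ x)
  have hfin : x ∈ E.heightFin h :=
    E.mem_heightFin_of_isMonicRoot hh hroot fun i =>
      ((minpoly (E.heightFinSubfield hh) x).coeff i).2
  exact IntermediateField.mem_bot.mpr ⟨⟨x, hfin⟩, rfl⟩

end HeightFinSubfield

end NonstandardExtension

theorem lemma3p4_general {K : Type u} [Field K] [CharZero K] [Algebra.IsAlgebraic ℚ K]
    (E : NonstandardExtension.{u, 0, w} K ℝ) :
    ∃ L : Subfield E.Fst,
      (L : Set E.Fst) = E.heightFin NumberField.absLogHeight₁ ∧ algebraicClosure L E.Fst = ⊥ :=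
  ⟨E.heightFinSubfield (isHeightLike_absLogHeight₁ K), rfl,
    E.algebraicClosure_heightFinSubfield_eq_bot _⟩

/-- `AlgebraicClosure.isAlgebraic` is about the `ℚ`-algebra structure of the construction, whereas
the height uses that of a division ring of characteristic zero. -/
instance isAlgebraic_rat_algebraicClosure : Algebra.IsAlgebraic ℚ (AlgebraicClosure ℚ) := by
  rw [Subsingleton.elim (DivisionRing.toRatAlgebra : Algebra ℚ (AlgebraicClosure ℚ))
    (AlgebraicClosure.instAlgebra ℚ)]
  exact AlgebraicClosure.isAlgebraic ℚ

theorem lemma3p4 (E : NonstandardExtension.{0, 0, w} (AlgebraicClosure ℚ) ℝ) :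
    ∃ L : Subfield E.Fst,
      (L : Set E.Fst) = E.heightFin NumberField.absLogHeight₁ ∧ IsAlgClosed L :=
  (lemma3p4_general E).imp fun _ =>
    And.imp_right (IsAlgClosed.algebraicClosure_eq_bot_iff _ _).mp
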